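/- Let $V$ be a finite set. A simplicial complex on the ground set $V$ is a collection $\Delta$ of subsets of $V$ (faces) closed under taking subsets; elements of $V$ need not be vertices of $\Delta$, and both the void complex $\emptyset$ and the empty complex $\{\emptyset\}$ are allowed. Facets are the inclusion-maximal faces; $\Delta$ is pure if all its facets have the same cardinality; $\dim\Delta$ is the largest value of $|F|-1$ over the facets $F$ (so $\dim\{\emptyset\}=-1$, and $\dim\emptyset=-\infty$). For a vertex $v$ of $\Delta$ let $\mathrm{del}_\Delta(v)=\{G\in\Delta : v\notin G\}$ and $\mathrm{lk}_\Delta(v)=\{G\in\Delta : v\notin G,\ G\cup\{v\}\in\Delta\}$. Recursively, $\Delta$ is vertex decomposable if $\Delta=\emptyset$, or $\Delta=2^W$ for some $W\subseteq V$, or $\Delta$ has a vertex $v$ such that $\mathrm{del}_\Delta(v)$ and $\mathrm{lk}_\Delta(v)$ are vertex decomposable and every facet of $\mathrm{del}_\Delta(v)$ is a facet of $\Delta$. A shelling of a pure $d$-dimensional complex $\Delta$ is an ordering $F_1,\dots,F_s$ of its facets (each listed once) such that for every $2\le k\le s$ the complex $\big(\bigcup_{i<k}2^{F_i}\big)\cap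 2^{F_k}$ is pure of dimension $d-1$. **Corollary.** Let $\Delta$ be a pure vertex decomposable simplicial complex on the finite ground set $V$, and let $d=\dim\Delta$. Then $\Delta$ is shelling completable: there is a shelling $F_1,\dots,F_s$ of $\Delta$ that is the initial sequence of some shelling of the $d$-skeleton $\{F\subseteq V : |F|-1\le d\}$ of the simplex on $V$. Moreover, every shelling of $\Delta$ is the initial sequence of some shelling of this $d$-skeleton. (For the void complex the $d$-skeleton is void and the statement is trivial.) -/

import Mathlib

/-- A simplicial complex on the finite ground set `V`: a collection of subsets of `V` closed under
taking subsets. An element of `V` need not be a vertex. The void complex `⊥` (no faces) and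
the empty complex `{∅}` are both allowed, and are different. -/
abbrev AbsComplex (V : Type*) := LowerSet (Finset V)

namespace AbsComplex

/-- A facet is an inclusion-maximal face. -/
def IsFacet {V : Type*} (Δ : AbsComplex V) (F : Finset V) : Prop :=
  Maximal (fun G => G ∈ Δ) F

/-- A complex is pure if all its facets have the same cardinality. -/
def IsPure {V : Type*} (Δ : AbsComplex V) : Prop :=
  ∀ F G : Finset V, IsFacet Δ F → IsFacet Δ G → F.card = G.card

/-- The dimension `|F| - 1` of a set `F`, so that `∅` has dimension `-1`. -/
def faceDim {V : Type*} (F : Finset V) : WithBot ℤ :=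
  (((F.card : ℤ) - 1 : ℤ) : WithBot ℤ)

open Classical in
/-- The dimension of a complex: the largest dimension of a facet. It is `-1` for the empty complex
`{∅}` and `⊥` (that is, minus infinity) for the void complex. -/
noncomputable def dim {V : Type*} [Fintype V] (Δ : AbsComplex V) : WithBot ℤ :=
  (Finset.univ.filter (fun F => IsFacet Δ F)).sup faceDim

/-- The link of `F`: the faces `G` disjoint from `F` for which `G ∪ F` is a face. -/
def link {V : Type*} [DecidableEq V] (Δ : AbsComplex V) (F : Finset V) : AbsComplex V where
  carrier := {G | G ∈ Δ ∧ Disjoint G F ∧ G ∪ F ∈ Δ}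
  lower' := fun _ _ hHG hG =>
    ⟨Δ.lower hHG hG.1, Finset.disjoint_of_subset_left hHG hG.2.1,
      Δ.lower (Finset.union_subset_union_left hHG) hG.2.2⟩

/-- The deletion of `F`: the faces that do not contain `F`. -/
def deletion {V : Type*} (Δ : AbsComplex V) (F : Finset V) : AbsComplex V where
  carrier := {G | G ∈ Δ ∧ ¬ F ⊆ G}
  lower' := fun _ _ hHG hG => ⟨Δ.lower hHG hG.1, fun h => hG.2 (h.trans hHG)⟩

/-- Vertex decomposable complexes, recursively. `LowerSet.Iic W` is the simplex `2^W` of all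
subsets of `W`; for `W = ∅` it is the empty complex. -/
inductive IsVertexDecomposable {V : Type*} [DecidableEq V] : AbsComplex V → Prop
  | void : IsVertexDecomposable ⊥
  | simplex (W : Finset V) : IsVertexDecomposable (LowerSet.Iic W)
  | decomposing (Δ : AbsComplex V) (v : V) (hv : {v} ∈ Δ)
      (hdel : IsVertexDecomposable (deletion Δ {v}))
      (hlink : IsVertexDecomposable (link Δ {v}))
      (hshed : ∀ F : Finset V, IsFacet (deletion Δ {v}) F → IsFacet Δ F) :
      IsVertexDecomposable Δ

/-- A shelling of a pure complex `Δ` of dimension `d`: an ordering, without repetition, of its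
facets such that each facet after the first meets the complex generated by the preceding ones in
a complex that is pure of dimension `d - 1`. -/
def IsShelling {V : Type*} [Fintype V] (Δ : AbsComplex V) (L : List (Finset V)) : Prop :=
  IsPure Δ ∧ L.Nodup ∧ (∀ F : Finset V, F ∈ L ↔ IsFacet Δ F) ∧
    ∀ (k : ℕ) (hk : k < L.length), 0 < k →
      let Γ : AbsComplex V :=
        lowerClosure {F : Finset V | F ∈ L.take k} ⊓ LowerSet.Iic (L[k]'hk)
      IsPure Γ ∧ dim Γ + 1 = dim Δ

/-- The `d`-skeleton of the simplex on the ground set `V`: all subsets of dimension at most `d`. -/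
def simplexSkeleton (V : Type*) (d : WithBot ℤ) : AbsComplex V where
  carrier := {F | faceDim F ≤ d}
  lower' := fun _ _ hHG hG =>
    le_trans (WithBot.coe_le_coe.mpr
      (sub_le_sub_right (Int.ofNat_le.mpr (Finset.card_le_card hHG)) 1)) hG

/-- A pure complex `Δ` of dimension `d` is shelling completable if some shelling of `Δ` is an
initial sequence of some shelling of the `d`-skeleton of the simplex on the ground set. -/
def IsShellingCompletable {V : Type*} [Fintype V] (Δ : AbsComplex V) : Prop :=
  IsPure Δ ∧ ∃ L L' : List (Finset V),
    IsShelling Δ L ∧ IsShelling (simplexSkeleton V (dim Δ)) L' ∧ L <+: L'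

end AbsComplex

namespace AbsComplex

/-! Whether a facet may come next in a shelling depends only on the set of earlier facets, not on
their order. So it suffices to attach all remaining sets of the right size, one after the other, to
the facet set of Δ; the same order of additions then continues every shelling of Δ.

Such an order comes by induction on the vertex decomposition, for an arbitrary ground set S. At a
shedding vertex v, the facets of Δ are those of the deletion together with the cones v ∪ L over
those of the link, and the (r+1)-subsets of S split in the same way over S \ {v}. First add the
missing sets avoiding v, as for the deletion; then add v ∪ B for the missing B, as for the link. The
two halves do not interfere (`AttachesList.union_cone`, `AttachesList.map_insert`) because each link
facet lies in a deletion facet, which is what shedding provides. The same gluing, started from the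
empty family, shells Δ itself. -/

/-- The subsets of `S` of cardinality `r`. -/
def subsetsOfCard {V : Type*} (S : Finset V) (r : ℕ) : Set (Finset V) :=
  {F | F ⊆ S ∧ F.card = r}

theorem subsetsOfCard_subsingleton {V : Type*} {S : Finset V} {r : ℕ} (h : r = 0 ∨ S.card ≤ r) :
    (subsetsOfCard S r).Subsingleton := by
  rintro F ⟨hF, hFc⟩ G ⟨hG, hGc⟩
  rcases h with rfl | h
  · rw [Finset.card_eq_zero.1 hFc, Finset.card_eq_zero.1 hGc]
  · rw [Finset.eq_of_subset_of_card_le hF (hFc ▸ h), Finset.eq_of_subset_of_card_le hG (hGc ▸ h)]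

/-! ### Attaching sets to a family one at a time -/

section Extension

variable {V : Type*} [DecidableEq V]

/-- Relative to the sets already in `𝓕`, the set `A` is attached along a nonempty union of
codimension one faces, or `𝓕` is empty. -/
def Attaches (𝓕 : Set (Finset V)) (A : Finset V) : Prop :=
  ∀ G ∈ 𝓕, ∃ H ∈ 𝓕, A ∩ G ⊆ A ∩ H ∧ (A ∩ H).card + 1 = A.card

/-- The sets of the list can be attached to `𝓕` one after the other. -/
def AttachesList : Set (Finset V) → List (Finset V) → Prop
  | _, [] => True
  | 𝓕, A :: T => Attaches 𝓕 A ∧ AttachesList (insert A 𝓕) T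

/-- The family `𝓕` can be extended to `𝓖` by attaching the missing sets in some order. -/
def ShellsTo (𝓕 𝓖 : Set (Finset V)) : Prop :=
  ∃ T : List (Finset V), T.Nodup ∧ (∀ F, F ∈ T ↔ F ∈ 𝓖 ∧ F ∉ 𝓕) ∧ AttachesList 𝓕 T

theorem attachesList_append {𝓕 : Set (Finset V)} {T U : List (Finset V)}
    (hT : AttachesList 𝓕 T) (hU : AttachesList (𝓕 ∪ {F | F ∈ T}) U) :
    AttachesList 𝓕 (T ++ U) := by
  induction T generalizing 𝓕 with
  | nil => simpa using hU
  | cons A T ih =>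
    refine ⟨hT.1, ih hT.2 ?_⟩
    convert hU using 1
    ext F
    simp only [Set.mem_union, Set.mem_insert_iff, Set.mem_ofPred_eq, List.mem_cons]
    tauto

theorem AttachesList.attaches_getElem {𝓕 : Set (Finset V)} {T : List (Finset V)}
    (hT : AttachesList 𝓕 T) (k : ℕ) (hk : k < T.length) :
    Attaches (𝓕 ∪ {F | F ∈ T.take k}) T[k] := by
  induction T generalizing 𝓕 k with
  | nil => simp at hk
  | cons A T ih =>
    cases k with
    | zero => simpa using hT.1
    | succ k =>
      have := ih hT.2 k (by simpa using hk)
      simp only [List.getElem_cons_succ, List.take_succ_cons]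
      convert this using 1
      ext F
      simp only [Set.mem_union, Set.mem_insert_iff, Set.mem_ofPred_eq, List.mem_cons]
      tauto

/-- Cones already present do no harm: for v ∉ A, the intersection of A with v ∪ L is A ∩ L, which
lies in A ∩ D for some D ⊇ L in the family. -/
theorem AttachesList.union_cone {𝓓 𝓛 : Set (Finset V)} {T : List (Finset V)} {v : V}
    (hT : AttachesList 𝓓 T) (hv : ∀ A ∈ T, v ∉ A) (hL : ∀ L ∈ 𝓛, ∃ D ∈ 𝓓, L ⊆ D) :
    AttachesList (𝓓 ∪ insert v '' 𝓛) T := by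
  induction T generalizing 𝓓 with
  | nil => trivial
  | cons A T ih =>
    have hvA : v ∉ A := hv A (by simp)
    refine ⟨?_, ?_⟩
    · rintro G (hG | ⟨L, hL', rfl⟩)
      · obtain ⟨H, hH, h⟩ := hT.1 G hG
        exact ⟨H, Or.inl hH, h⟩
      · obtain ⟨D, hD, hLD⟩ := hL L hL'
        obtain ⟨H, hH, h1, h2⟩ := hT.1 D hD
        refine ⟨H, Or.inl hH, ?_, h2⟩
        rw [Finset.inter_insert_of_notMem hvA]
        exact (Finset.inter_subset_inter_left hLD).trans h1
    · rw [← Set.insert_union]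
      refine ih hT.2 (fun B hB => hv B (by simp [hB])) fun L hL' => ?_
      obtain ⟨D, hD, h⟩ := hL L hL'
      exact ⟨D, Or.inr hD, h⟩

/-- The set v ∪ B meets any member avoiding v inside B, and B itself is such an intersection, of
codimension one, since some D contains it. Against the cones, v is added to both sides of the
condition for B. -/
theorem AttachesList.map_insert {𝓓 𝓛 : Set (Finset V)} {T : List (Finset V)} {v : V}
    (hT : AttachesList 𝓛 T) (hv : ∀ B ∈ T, v ∉ B) (hvD : ∀ D ∈ 𝓓, v ∉ D)
    (hTD : ∀ B ∈ T, ∃ D ∈ 𝓓, B ⊆ D) :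
    AttachesList (𝓓 ∪ insert v '' 𝓛) (T.map (insert v)) := by
  induction T generalizing 𝓛 with
  | nil => trivial
  | cons B T ih =>
    have hvB : v ∉ B := hv B (by simp)
    refine ⟨?_, ?_⟩
    · rintro G (hG | ⟨L, hL, rfl⟩)
      · obtain ⟨D, hD, hBD⟩ := hTD B (by simp)
        refine ⟨D, Or.inl hD, ?_, ?_⟩
        · rw [Finset.insert_inter_of_notMem (hvD G hG), Finset.insert_inter_of_notMem (hvD D hD),
            Finset.inter_eq_left.mpr hBD]
          exact Finset.inter_subset_left
        · rw [Finset.insert_inter_of_notMem (hvD D hD), Finset.inter_eq_left.mpr hBD,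
            Finset.card_insert_of_notMem hvB]
      · obtain ⟨H, hH, h1, h2⟩ := hT.1 L hL
        refine ⟨insert v H, Or.inr ⟨H, hH, rfl⟩, ?_, ?_⟩
        · rw [← Finset.insert_inter_distrib, ← Finset.insert_inter_distrib]
          exact Finset.insert_subset_insert _ h1
        · rw [← Finset.insert_inter_distrib, Finset.card_insert_of_notMem (by simp [hvB]),
            Finset.card_insert_of_notMem hvB, h2]
    · have := ih hT.2 (fun C hC => hv C (by simp [hC])) (fun C hC => hTD C (by simp [hC]))
      rwa [Set.image_insert_eq, Set.union_insert] at this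

theorem ShellsTo.refl (𝓕 : Set (Finset V)) : ShellsTo 𝓕 𝓕 :=
  ⟨[], List.nodup_nil, by simp, trivial⟩

theorem ShellsTo.of_subsingleton {𝓖 : Set (Finset V)} (h : 𝓖.Subsingleton) :
    ShellsTo ∅ 𝓖 := by
  rcases h.eq_empty_or_singleton with rfl | ⟨A, rfl⟩
  · exact .refl _
  · exact ⟨[A], by simp, by simp, by simp [Attaches], trivial⟩

/-- Extensions of a deletion and of a link combine to an extension of the whole family. -/
theorem ShellsTo.union_cone {𝓓 𝓓' 𝓛 𝓛' : Set (Finset V)} {v : V}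
    (hD : ShellsTo 𝓓 𝓓') (hL : ShellsTo 𝓛 𝓛') (hDD : 𝓓 ⊆ 𝓓') (hLL : 𝓛 ⊆ 𝓛')
    (hvD : ∀ D ∈ 𝓓', v ∉ D) (hvL : ∀ L ∈ 𝓛', v ∉ L)
    (hLD : ∀ L ∈ 𝓛, ∃ D ∈ 𝓓, L ⊆ D) (hLD' : ∀ L ∈ 𝓛', ∃ D ∈ 𝓓', L ⊆ D) :
    ShellsTo (𝓓 ∪ insert v '' 𝓛) (𝓓' ∪ insert v '' 𝓛') := by
  obtain ⟨T, hT, hTm, hTa⟩ := hD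
  obtain ⟨U, hU, hUm, hUa⟩ := hL
  have hinj : ∀ A B : Finset V, v ∉ A → v ∉ B → insert v A = insert v B → A = B := by
    intro A B hA hB h
    rw [← Finset.erase_insert hA, h, Finset.erase_insert hB]
  refine ⟨T ++ U.map (insert v), ?_, ?_, ?_⟩
  · refine List.nodup_append'.mpr ⟨hT, ?_, ?_⟩
    · exact List.Nodup.map_on (fun A hA B hB => hinj A B (hvL A ((hUm A).1 hA).1)
        (hvL B ((hUm B).1 hB).1)) hU
    · intro A hA hA'
      obtain ⟨B, -, rfl⟩ := List.mem_map.1 hA'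
      exact hvD _ ((hTm _).1 hA).1 (by simp)
  · intro F
    simp only [List.mem_append, List.mem_map, Set.mem_union, Set.mem_image, hTm, hUm]
    constructor
    · rintro (⟨h1, h2⟩ | ⟨B, ⟨h1, h2⟩, rfl⟩)
      · refine ⟨Or.inl h1, ?_⟩
        rintro (h | ⟨L, -, rfl⟩)
        · exact h2 h
        · exact hvD _ h1 (by simp)
      · refine ⟨Or.inr ⟨B, h1, rfl⟩, ?_⟩
        rintro (h | ⟨L, hL, h⟩)
        · exact hvD _ (hDD h) (by simp)
        · exact h2 (hinj L B (hvL L (hLL hL)) (hvL B h1) h ▸ hL)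
    · rintro ⟨h1 | ⟨B, h1, rfl⟩, h2⟩
      · exact Or.inl ⟨h1, fun h => h2 (Or.inl h)⟩
      · exact Or.inr ⟨B, ⟨h1, fun h => h2 (Or.inr ⟨B, h, rfl⟩)⟩, rfl⟩
  · refine attachesList_append
      (hTa.union_cone (fun A hA => hvD A ((hTm A).1 hA).1) hLD) ?_
    have hunion : 𝓓 ∪ insert v '' 𝓛 ∪ {F | F ∈ T} = 𝓓' ∪ insert v '' 𝓛 := by
      ext F
      have := @hDD F
      simp only [Set.mem_union, Set.mem_ofPred_eq, hTm]
      tauto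
    rw [hunion]
    exact hUa.map_insert (fun B hB => hvL B ((hUm B).1 hB).1) hvD
      (fun B hB => hLD' B ((hUm B).1 hB).1)

theorem subsetsOfCard_insert {S : Finset V} {v : V} (hv : v ∉ S) (r : ℕ) :
    subsetsOfCard (insert v S) (r + 1) =
      subsetsOfCard S (r + 1) ∪ insert v '' subsetsOfCard S r := by
  ext F
  simp only [subsetsOfCard, Set.mem_union, Set.mem_image, Set.mem_ofPred_eq]
  constructor
  · rintro ⟨hF, hc⟩
    by_cases h : v ∈ F
    · refine Or.inr ⟨F.erase v, ⟨Finset.subset_insert_iff.1 hF, ?_⟩, Finset.insert_erase h⟩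
      rw [Finset.card_erase_of_mem h, hc, Nat.add_sub_cancel]
    · exact Or.inl ⟨(Finset.subset_insert_iff_of_notMem h).1 hF, hc⟩
  · rintro (⟨hF, hc⟩ | ⟨G, ⟨hG, hc⟩, rfl⟩)
    · exact ⟨hF.trans (Finset.subset_insert _ _), hc⟩
    · exact ⟨Finset.insert_subset_insert _ hG,
        by rw [Finset.card_insert_of_notMem (fun h => hv (hG h)), hc]⟩

/-- Combining extensions to all subsets of the given cardinality. -/
theorem ShellsTo.subsetsOfCard_insert {S : Finset V} {v : V} {r : ℕ} {𝓓 𝓛 : Set (Finset V)}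
    (hv : v ∉ S) (hr : r + 1 ≤ S.card)
    (hD : ShellsTo 𝓓 (subsetsOfCard S (r + 1))) (hL : ShellsTo 𝓛 (subsetsOfCard S r))
    (hDS : 𝓓 ⊆ subsetsOfCard S (r + 1)) (hLS : 𝓛 ⊆ subsetsOfCard S r)
    (hLD : ∀ L ∈ 𝓛, ∃ D ∈ 𝓓, L ⊆ D) :
    ShellsTo (𝓓 ∪ insert v '' 𝓛) (subsetsOfCard (insert v S) (r + 1)) := by
  rw [AbsComplex.subsetsOfCard_insert hv]
  refine hD.union_cone hL hDS hLS (fun D h hvD => hv (h.1 hvD)) (fun D h hvD => hv (h.1 hvD))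
    hLD ?_
  rintro L ⟨hLS, hc⟩
  obtain ⟨D, h1, h2, h3⟩ := Finset.exists_subsuperset_card_eq hLS (by omega : L.card ≤ r + 1) hr
  exact ⟨D, ⟨h2, h3⟩, h1⟩

/-- Pascal's recursion on S, gluing two extensions of the empty family. -/
theorem shellsTo_subsetsOfCard_of_empty (S : Finset V) (r : ℕ) :
    ShellsTo ∅ (subsetsOfCard S r) := by
  induction S using Finset.induction_on generalizing r with
  | empty => exact .of_subsingleton (subsetsOfCard_subsingleton (by simp))
  | insert v S hv ih =>
    by_cases h : r = 0 ∨ (insert v S).card ≤ r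
    · exact .of_subsingleton (subsetsOfCard_subsingleton h)
    · rw [Finset.card_insert_of_notMem hv] at h
      obtain ⟨r, rfl⟩ : ∃ k, r = k + 1 := ⟨r - 1, by omega⟩
      simpa using ShellsTo.subsetsOfCard_insert hv (by omega) (ih (r + 1)) (ih r)
        (Set.empty_subset _) (Set.empty_subset _) (by simp)

/-- Split off a vertex v outside W: the half avoiding v starts from W, the cone half from nothing.
-/
theorem shellsTo_subsetsOfCard_of_singleton {W S : Finset V} (hW : W ⊆ S) :
    ShellsTo {W} (subsetsOfCard S W.card) := by
  induction S using Finset.strongInduction with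
  | H S ih =>
    have hmem : W ∈ subsetsOfCard S W.card := ⟨hW, rfl⟩
    by_cases h : W.card = 0 ∨ S.card ≤ W.card
    · rw [(subsetsOfCard_subsingleton h).eq_singleton_of_mem hmem]
      exact .refl _
    · obtain ⟨v, hvS, hvW⟩ : ∃ v ∈ S, v ∉ W := by
        by_contra! hc
        exact h (Or.inr (Finset.card_le_card hc))
      have hWS : W ⊆ S.erase v := Finset.subset_erase.2 ⟨hW, hvW⟩
      obtain ⟨r, hr⟩ : ∃ k, W.card = k + 1 := ⟨W.card - 1, by omega⟩
      have ih' := ih (S.erase v) (Finset.erase_ssubset hvS) hWS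
      rw [hr] at ih'
      have := ih'.subsetsOfCard_insert (S.notMem_erase v)
        (by rw [Finset.card_erase_of_mem hvS]; omega)
        (shellsTo_subsetsOfCard_of_empty (S.erase v) r)
        (by rintro _ rfl; exact ⟨hWS, hr⟩) (Set.empty_subset _) (by simp)
      rw [hr]
      simpa [Finset.insert_erase hvS] using this

end Extension

/-! ### Vertex decomposable complexes -/

section Complex

variable {V : Type*}

/-- The faces of cardinality `r`. -/
def facesOfCard (Δ : AbsComplex V) (r : ℕ) : Set (Finset V) :=
  {F | F ∈ Δ ∧ F.card = r}

theorem exists_facet_superset [Finite V] {Δ : AbsComplex V} {F : Finset V} (hF : F ∈ Δ) :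
    ∃ G, F ⊆ G ∧ IsFacet Δ G :=
  (Set.toFinite {G | G ∈ Δ}).exists_le_maximal hF

theorem isFacet_iff_mem_facesOfCard [Finite V] {Δ : AbsComplex V} {r : ℕ}
    (h : ∀ F, IsFacet Δ F → F.card = r) (F : Finset V) :
    IsFacet Δ F ↔ F ∈ facesOfCard Δ r := by
  refine ⟨fun hF => ⟨hF.prop, h F hF⟩, fun hF => ?_⟩
  obtain ⟨G, hFG, hG⟩ := exists_facet_superset hF.1
  rwa [Finset.eq_of_subset_of_card_le hFG (by rw [h G hG, hF.2])]

theorem dim_eq_of_facet_card [Fintype V] {Δ : AbsComplex V} {r : ℕ}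
    (h : ∀ F, IsFacet Δ F → F.card = r) {G : Finset V} (hG : IsFacet Δ G) :
    dim Δ = (((r : ℤ) - 1 : ℤ) : WithBot ℤ) := by
  classical
  unfold dim
  apply le_antisymm
  · refine Finset.sup_le fun F hF => ?_
    rw [faceDim, h F (by simpa using hF)]
  · rw [← h G hG]
    exact Finset.le_sup (f := faceDim) (by simpa using hG)

theorem isFacet_link [DecidableEq V] {Δ : AbsComplex V} {v : V} {F : Finset V}
    (hF : IsFacet (link Δ {v}) F) : v ∉ F ∧ IsFacet Δ (insert v F) := by
  obtain ⟨h1, h2, h3⟩ := hF.prop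
  have hv : v ∉ F := by simpa using h2
  have h3' : insert v F ∈ Δ := by simpa [Finset.union_comm, ← Finset.insert_eq] using h3
  refine ⟨hv, h3', fun G hG hFG => ?_⟩
  have hvG : v ∈ G := hFG (by simp)
  have hmem : G.erase v ∈ link Δ {v} := by
    refine ⟨Δ.lower (Finset.erase_subset _ _) hG, by simp, ?_⟩
    rwa [Finset.union_comm, ← Finset.insert_eq, Finset.insert_erase hvG]
  have := hF.le_of_ge hmem (Finset.subset_erase.2 ⟨(Finset.subset_insert _ _).trans hFG, hv⟩)
  rw [← Finset.insert_erase hvG]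
  exact Finset.insert_subset_insert _ this

theorem facesOfCard_succ [DecidableEq V] (Δ : AbsComplex V) (v : V) (r : ℕ) :
    facesOfCard Δ (r + 1) =
      facesOfCard (deletion Δ {v}) (r + 1) ∪ insert v '' facesOfCard (link Δ {v}) r := by
  ext F
  constructor
  · rintro ⟨hF, hc⟩
    by_cases h : v ∈ F
    · refine Or.inr ⟨F.erase v, ⟨⟨Δ.lower (Finset.erase_subset _ _) hF, by simp, ?_⟩, ?_⟩,
        Finset.insert_erase h⟩
      · rwa [Finset.union_comm, ← Finset.insert_eq, Finset.insert_erase h]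
      · rw [Finset.card_erase_of_mem h, hc, Nat.add_sub_cancel]
    · exact Or.inl ⟨⟨hF, by simpa using h⟩, hc⟩
  · rintro (⟨hF, hc⟩ | ⟨G, ⟨⟨h1, h2, h3⟩, hc⟩, rfl⟩)
    · exact ⟨hF.1, hc⟩
    · refine ⟨by simpa [Finset.union_comm, ← Finset.insert_eq] using h3, ?_⟩
      rw [Finset.card_insert_of_notMem (by simpa using h2), hc]

/-- The facets of a pure vertex decomposable complex can be shelled, and such a shelling can be
continued through all sets of the same cardinality in the ground set `S`. -/
theorem IsVertexDecomposable.shellsTo [Finite V] [DecidableEq V] {Δ : AbsComplex V}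
    (hΔ : IsVertexDecomposable Δ) {r : ℕ} {S : Finset V}
    (hr : ∀ F, IsFacet Δ F → F.card = r) (hS : ∀ F ∈ Δ, F ⊆ S) :
    ShellsTo ∅ (facesOfCard Δ r) ∧ ShellsTo (facesOfCard Δ r) (subsetsOfCard S r) := by
  induction hΔ generalizing r S with
  | void =>
    have : facesOfCard (⊥ : AbsComplex V) r = ∅ := by
      ext F; simp [facesOfCard]
    rw [this]
    exact ⟨.refl _, shellsTo_subsetsOfCard_of_empty S r⟩
  | simplex W =>
    have hW : IsFacet (LowerSet.Iic W) W := ⟨LowerSet.mem_Iic_iff.2 le_rfl, fun G hG _ => hG⟩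
    obtain rfl := hr W hW
    have : facesOfCard (LowerSet.Iic W) W.card = {W} := by
      ext F
      constructor
      · rintro ⟨h1, h2⟩
        exact Finset.eq_of_subset_of_card_le h1 h2.ge
      · rintro rfl
        exact ⟨hW.prop, rfl⟩
    rw [this]
    exact ⟨.of_subsingleton Set.subsingleton_singleton,
      shellsTo_subsetsOfCard_of_singleton (hS W hW.prop)⟩
  | decomposing Δ v hv _ _ hshed ihD ihL =>
    have hvS : v ∈ S := hS _ hv (by simp)
    obtain ⟨r, rfl⟩ : ∃ k, r = k + 1 := by
      obtain ⟨G, hG, hGf⟩ := exists_facet_superset hv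
      have := Finset.card_le_card hG
      rw [hr G hGf, Finset.card_singleton] at this
      exact ⟨r - 1, by omega⟩
    have hrD : ∀ F, IsFacet (deletion Δ {v}) F → F.card = r + 1 := fun F hF => hr F (hshed F hF)
    have hrL : ∀ F, IsFacet (link Δ {v}) F → F.card = r := by
      intro F hF
      obtain ⟨h1, h2⟩ := isFacet_link hF
      have := hr _ h2
      rwa [Finset.card_insert_of_notMem h1, Nat.add_right_cancel_iff] at this
    have hvD : ∀ F ∈ deletion Δ {v}, v ∉ F := fun F hF => by simpa using hF.2
    have hvL : ∀ F ∈ link Δ {v}, v ∉ F := fun F hF => by simpa using hF.2.1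
    have hSD : ∀ F ∈ deletion Δ {v}, F ⊆ S.erase v := fun F hF =>
      Finset.subset_erase.2 ⟨hS F hF.1, hvD F hF⟩
    have hSL : ∀ F ∈ link Δ {v}, F ⊆ S.erase v := fun F hF =>
      Finset.subset_erase.2 ⟨hS F hF.1, hvL F hF⟩
    have hex : ∀ F ∈ deletion Δ {v}, ∃ D ∈ facesOfCard (deletion Δ {v}) (r + 1), F ⊆ D := by
      intro F hF
      obtain ⟨G, hFG, hG⟩ := exists_facet_superset hF
      exact ⟨G, ⟨hG.prop, hrD G hG⟩, hFG⟩
    -- A link face is a face of the deletion, whose facets have r + 1 elements by shedding.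
    have hLD : ∀ L ∈ facesOfCard (link Δ {v}) r,
        ∃ D ∈ facesOfCard (deletion Δ {v}) (r + 1), L ⊆ D :=
      fun L hL => hex L ⟨hL.1.1, by simpa using hvL L hL.1⟩
    -- A facet of the deletion shows that S \ {v} has at least r + 1 elements, as the gluing
    -- requires.
    obtain ⟨D, hD, -⟩ := hex ∅ ⟨Δ.lower (Finset.empty_subset _) hv, by simp⟩
    have hcard : r + 1 ≤ (S.erase v).card := hD.2 ▸ Finset.card_le_card (hSD D hD.1)
    obtain ⟨hD1, hD2⟩ := ihD hrD hSD
    obtain ⟨hL1, hL2⟩ := ihL hrL hSL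
    rw [facesOfCard_succ Δ v]
    constructor
    · simpa using hD1.union_cone hL1 (Set.empty_subset _) (Set.empty_subset _)
        (fun D h => hvD D h.1) (fun L h => hvL L h.1) (by simp) hLD
    · rw [← Finset.insert_erase hvS]
      exact hD2.subsetsOfCard_insert (S.notMem_erase v) hcard hL2
        (fun D h => ⟨hSD D h.1, h.2⟩) (fun L h => ⟨hSL L h.1, h.2⟩) hLD

/-! ### From attaching to shellings -/

theorem Attaches.isPure_and_dim [Fintype V] [DecidableEq V] {𝓕 : Set (Finset V)} {A : Finset V}
    (hA : Attaches 𝓕 A) (h𝓕 : 𝓕.Nonempty) :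
    IsPure (lowerClosure 𝓕 ⊓ LowerSet.Iic A : AbsComplex V) ∧
      dim (lowerClosure 𝓕 ⊓ LowerSet.Iic A : AbsComplex V) + 1 = faceDim A := by
  have hcard : ∀ F, IsFacet (lowerClosure 𝓕 ⊓ LowerSet.Iic A) F → F.card = A.card - 1 := by
    rintro F ⟨⟨⟨G, hG, hFG⟩, hFA⟩, hmax⟩
    obtain ⟨H, hH, h1, h2⟩ := hA G hG
    have hFH : F ⊆ A ∩ H := (Finset.subset_inter hFA hFG).trans h1
    have hmem : A ∩ H ∈ (lowerClosure 𝓕 ⊓ LowerSet.Iic A : AbsComplex V) :=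
      ⟨⟨H, hH, Finset.inter_subset_right⟩, Finset.inter_subset_left⟩
    rw [hFH.antisymm (hmax hmem hFH)]
    omega
  refine ⟨fun F G hF hG => by rw [hcard F hF, hcard G hG], ?_⟩
  obtain ⟨G, hG⟩ := h𝓕
  -- The intersection is not void, so its dimension is not `⊥`.
  have hempty : ∅ ∈ (lowerClosure 𝓕 ⊓ LowerSet.Iic A : AbsComplex V) :=
    ⟨⟨G, hG, Finset.empty_subset _⟩, Finset.empty_subset _⟩
  obtain ⟨F, -, hF⟩ := exists_facet_superset hempty
  -- This forces A to be nonempty, so the truncated `A.card - 1` is exact.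
  obtain ⟨H, -, -, hH⟩ := hA G hG
  rw [dim_eq_of_facet_card hcard hF, faceDim, ← WithBot.coe_one, ← WithBot.coe_add]
  congr 1
  omega

/-- A shelling of a complex of the same dimension, or the empty list, is continued to a shelling
of `Δ` by attaching the remaining facets of `Δ`. -/
theorem isShelling_append [Fintype V] [DecidableEq V] {Γ Δ : AbsComplex V} {r : ℕ}
    {L T : List (Finset V)} (hr : ∀ F, IsFacet Δ F → F.card = r)
    (hL : L = [] ∨ IsShelling Γ L ∧ dim Γ = dim Δ)
    (hnodup : (L ++ T).Nodup) (hmem : ∀ F, F ∈ L ++ T ↔ IsFacet Δ F)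
    (hT : AttachesList {F | F ∈ L} T) : IsShelling Δ (L ++ T) := by
  refine ⟨fun F G hF hG => by rw [hr F hF, hr G hG], hnodup, hmem, fun k hk hk0 => ?_⟩
  by_cases hkL : k < L.length
  · rcases hL with rfl | ⟨hL, hdim⟩
    · simp at hkL
    · rw [List.take_append_of_le_length hkL.le, List.getElem_append_left hkL, ← hdim]
      exact hL.2.2.2 k hkL hk0
  · rw [not_lt] at hkL
    have hkT : k - L.length < T.length := by rw [List.length_append] at hk; omega
    have hatt := hT.attaches_getElem (k - L.length) hkT
    have hfacet : IsFacet Δ T[k - L.length] := (hmem _).1 (by simp)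
    have hset : {F | F ∈ (L ++ T).take k} =
        {F | F ∈ L} ∪ {F | F ∈ T.take (k - L.length)} := by
      ext F
      rw [List.take_append, List.take_of_length_le hkL]
      simp
    rw [List.getElem_append_right hkL, hset, dim_eq_of_facet_card hr hfacet, ← hr _ hfacet]
    refine hatt.isPure_and_dim ?_
    rw [← hset]
    exact ⟨(L ++ T)[0], List.mem_take_iff_getElem.2 ⟨0, by omega, rfl⟩⟩

theorem isFacet_simplexSkeleton [Fintype V] {r : ℕ} (hr : r ≤ Fintype.card V) (F : Finset V) :
    IsFacet (simplexSkeleton V (((r : ℤ) - 1 : ℤ) : WithBot ℤ)) F ↔ F.card = r := by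
  have hmem : ∀ G : Finset V,
      G ∈ simplexSkeleton V (((r : ℤ) - 1 : ℤ) : WithBot ℤ) ↔ G.card ≤ r := by
    intro G
    change faceDim G ≤ _ ↔ _
    rw [faceDim, WithBot.coe_le_coe]
    omega
  constructor
  · intro hF
    have hle := (hmem F).1 hF.prop
    obtain ⟨G, hFG, -, hG⟩ := Finset.exists_subsuperset_card_eq (Finset.subset_univ F) hle
      (by rwa [Finset.card_univ])
    rwa [hF.eq_of_le ((hmem G).2 hG.le) hFG]
  · intro hF
    refine ⟨(hmem F).2 hF.le, fun G hG hFG => ?_⟩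
    exact (Finset.eq_of_subset_of_card_le hFG (by rw [hF]; exact (hmem G).1 hG)).ge

theorem simplexSkeleton_bot : simplexSkeleton V ⊥ = (⊥ : AbsComplex V) := by
  ext F
  change faceDim F ≤ ⊥ ↔ False
  simp [faceDim]

theorem isShelling_bot [Fintype V] : IsShelling (⊥ : AbsComplex V) [] := by
  have h : ∀ F : Finset V, ¬ IsFacet ⊥ F := fun F hF => hF.prop
  exact ⟨fun F _ hF => (h F hF).elim, List.nodup_nil, by simpa using h, by simp⟩

end Complex

end AbsComplex

/-! ### The corollary -/

open AbsComplex in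
theorem exists_shelling_and_extension {V : Type*} [Fintype V] [DecidableEq V] (Δ : AbsComplex V)
    (hpure : IsPure Δ) (hvd : IsVertexDecomposable Δ) :
    (∃ L, IsShelling Δ L) ∧ ∀ L : List (Finset V), IsShelling Δ L →
      ∃ L', IsShelling (simplexSkeleton V (dim Δ)) L' ∧ L <+: L' := by
  by_cases hne : ∃ G, IsFacet Δ G
  · obtain ⟨G, hG⟩ := hne
    have hr : ∀ F, IsFacet Δ F → F.card = G.card := fun F hF => hpure F G hF hG
    obtain ⟨⟨L, hLn, hLm, hLa⟩, T, hTn, hTm, hTa⟩ := hvd.shellsTo hr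
      (fun F _ => Finset.subset_univ F)
    have hfac := isFacet_iff_mem_facesOfCard hr
    have hdim := dim_eq_of_facet_card hr hG
    have hsk := isFacet_simplexSkeleton (Finset.card_le_univ G)
    refine ⟨⟨L, isShelling_append (Γ := Δ) (L := []) hr (Or.inl rfl) hLn
      (fun F => by simp [hLm, hfac]) (by simpa using hLa)⟩, fun L hL => ?_⟩
    have hset : {F | F ∈ L} = facesOfCard Δ G.card := by
      ext F
      rw [Set.mem_ofPred_eq, hL.2.2.1, hfac]
    have hLF : ∀ F, F ∈ L ↔ F ∈ facesOfCard Δ G.card := fun F => by rw [hL.2.2.1, hfac]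
    -- T was built from the facet set alone, so it serves for every shelling L.
    refine ⟨L ++ T, ?_, List.prefix_append _ _⟩
    rw [hdim]
    refine isShelling_append (Γ := Δ) (fun F => (hsk F).1)
      (Or.inr ⟨hL, ?_⟩) ?_ (fun F => ?_) (by rwa [hset])
    · rw [hdim, dim_eq_of_facet_card (fun F => (hsk F).1) ((hsk G).2 rfl)]
    · refine List.nodup_append'.2 ⟨hL.2.1, hTn, fun F hF hF' => ?_⟩
      exact ((hTm F).1 hF').2 ((hLF F).1 hF)
    · rw [List.mem_append, hTm, hLF, hsk]
      by_cases h : F ∈ facesOfCard Δ G.card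
      · simp [h, h.2]
      · simp [h, subsetsOfCard]
  · have hΔ : Δ = ⊥ := by
      ext F
      refine ⟨fun hF => ?_, False.elim⟩
      obtain ⟨G, -, hG⟩ := exists_facet_superset hF
      exact hne ⟨G, hG⟩
    have hdim : dim Δ = ⊥ := by
      classical
      unfold dim
      rw [Finset.filter_false_of_mem (fun F _ hF => hne ⟨F, hF⟩), Finset.sup_empty]
    rw [hdim, simplexSkeleton_bot, hΔ]
    exact ⟨⟨[], isShelling_bot⟩, fun L hL => ⟨L, hL, List.prefix_refl L⟩⟩

theorem corollary2p11 {V : Type*} [Fintype V] [DecidableEq V] (Δ : AbsComplex V)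
    (hpure : AbsComplex.IsPure Δ) (hvd : AbsComplex.IsVertexDecomposable Δ) :
    AbsComplex.IsShellingCompletable Δ ∧
      ∀ L : List (Finset V), AbsComplex.IsShelling Δ L →
        ∃ L' : List (Finset V),
          AbsComplex.IsShelling (AbsComplex.simplexSkeleton V (AbsComplex.dim Δ)) L' ∧
            L <+: L' := by
  obtain ⟨⟨L, hL⟩, hext⟩ := exists_shelling_and_extension Δ hpure hvd
  obtain ⟨L', hL', hpre⟩ := hext L hL
  exact ⟨⟨hpure, L, L', hL, hL', hpre⟩, hext⟩
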